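/- All surfaces of revolution are taken about the $z$-axis of Euclidean $3$-space and are parametrized as $\mathbf x(s,t)=(r(s)\cos t,\ r(s)\sin t,\ z(s))$, $(s,t)\in\mathbb R^2$, where the profile curve $(r,z)\colon\mathbb R\to(0,\infty)\times\mathbb R$ is smooth and parametrized by arc length on all of $\mathbb R$. The mean curvature is taken with respect to the unit normal $\mathbf n=\mathbf x_s\times\mathbf x_t/|\mathbf x_s\times\mathbf x_t|$. Let $H\neq 0$ be a real constant. Such a surface with constant mean curvature $H$ is called an *unduloid* if its profile curve is nowhere perpendicular to the axis ($z'(s)\neq 0$ for all $s$, so that the profile is a graph over the axis; the circular cylinder is admitted as the degenerate unduloid), and a *nodoid* if its profile curve is somewhere perpendicular to the axis ($z'(s)=0$ for some $s$). The *inner radius* $\rho$ and the *outer radius* $R$ of a surface are the infimum and the supremum of the distances of its points to the axis. Two surfaces are *associated (locally isometric)* if every point of either one has a neighbourhood that is mapped, by a smooth diffeomorphism preserving the first fundamental forms, onto an open piece of the other one. **Corollary 6.13 (unduloid vs nodoid).** Let $\mathbf x$ be an unduloid and $\mathbf y$ a nodoid with the same constant mean curvature $H\ne 0$. Then both surfaces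 are at bounded distance from the axis (so their outer radii are finite), and $\mathbf x$ and $\mathbf y$ are associated (locally isometric) if and only if their ratios of inner to outer radius coincide: $$\frac{\rho_{\mathbf x}}{R_{\mathbf x}}=\frac{\rho_{\mathbf y}}{R_{\mathbf y}}.$$ -/

import Mathlib

open scoped ContDiff Matrix

noncomputable section

namespace Delaunay

/-- Euclidean 3-space. -/
abbrev E3 := EuclideanSpace ℝ (Fin 3)

/-! ### Parametrized surfaces in Euclidean 3-space -/

/-- First partial derivative in the first parameter. -/
def partialU (x : ℝ × ℝ → E3) (p : ℝ × ℝ) : E3 := fderiv ℝ x p (1, 0)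

/-- First partial derivative in the second parameter. -/
def partialV (x : ℝ × ℝ → E3) (p : ℝ × ℝ) : E3 := fderiv ℝ x p (0, 1)

/-- The vector product of `ℝ³`. -/
def cross (a b : E3) : E3 := WithLp.toLp 2 (WithLp.ofLp a ⨯₃ WithLp.ofLp b)

/-- The Gauss map `n = (x_u × x_v) / |x_u × x_v|`. -/
def gaussMap (x : ℝ × ℝ → E3) (p : ℝ × ℝ) : E3 :=
  ‖cross (partialU x p) (partialV x p)‖⁻¹ • cross (partialU x p) (partialV x p)

/-- The first fundamental form `I_p(v, w) = ⟨dx_p v, dx_p w⟩`. -/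
def firstForm (x : ℝ × ℝ → E3) (p v w : ℝ × ℝ) : ℝ :=
  inner ℝ (fderiv ℝ x p v) (fderiv ℝ x p w)

/-- The mean curvature `H = (E N - 2 F M + G L) / (2 (E G - F²))`, where `E, F, G` and `L, M, N`
are the coefficients of the first and of the second fundamental form (with respect to the
Gauss map above). Used for immersions only. -/
def meanCurvature (x : ℝ × ℝ → E3) (p : ℝ × ℝ) : ℝ :=
  let E := inner ℝ (partialU x p) (partialU x p)
  let F := inner ℝ (partialU x p) (partialV x p)
  let G := inner ℝ (partialV x p) (partialV x p)
  let L := inner ℝ (partialU (partialU x) p) (gaussMap x p)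
  let M := inner ℝ (partialV (partialU x) p) (gaussMap x p)
  let N := inner ℝ (partialV (partialV x) p) (gaussMap x p)
  (E * N - 2 * F * M + G * L) / (2 * (E * G - F ^ 2))

/-- Every point of the surface `x` has a neighbourhood that is mapped by a smooth
diffeomorphism onto an open piece of the surface `y`, preserving the first fundamental forms. -/
def LocallyIsometricInto (x y : ℝ × ℝ → E3) : Prop :=
  ∀ p : ℝ × ℝ, ∃ φ : OpenPartialHomeomorph (ℝ × ℝ) (ℝ × ℝ),
    p ∈ φ.source ∧ ContDiffOn ℝ ∞ φ φ.source ∧ ContDiffOn ℝ ∞ φ.symm φ.target ∧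
    ∀ q ∈ φ.source, ∀ v w : ℝ × ℝ,
      firstForm y (φ q) (fderiv ℝ φ q v) (fderiv ℝ φ q w) = firstForm x q v w

/-- Two surfaces are locally isometric if every point of either one has a neighbourhood
isometric to an open piece of the other one. -/
def LocallyIsometric (x y : ℝ × ℝ → E3) : Prop :=
  LocallyIsometricInto x y ∧ LocallyIsometricInto y x

/-! ### Distance to the axis -/

/-- The distance of a point to the `z`-axis. -/
def axisDist (a : E3) : ℝ := √(a 0 ^ 2 + a 1 ^ 2)

/-- The set of distances of the points of a surface to the `z`-axis. -/
def axisDistances (x : ℝ × ℝ → E3) : Set ℝ := Set.range fun p => axisDist (x p)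

/-- The inner radius: the infimum of the distances to the axis. -/
def innerRadius (x : ℝ × ℝ → E3) : ℝ := sInf (axisDistances x)

/-- The outer radius: the supremum of the distances to the axis
(meaningful if the surface is bounded, i.e. lies inside a circular cylinder about the axis). -/
def outerRadius (x : ℝ × ℝ → E3) : ℝ := sSup (axisDistances x)

/-! ### Delaunay surfaces, unduloids, nodoids -/

/-- The surface of revolution about the `z`-axis with profile curve `(r, z)`. -/
def revolve (r z : ℝ → ℝ) (p : ℝ × ℝ) : E3 :=
  !₂[r p.1 * Real.cos p.2, r p.1 * Real.sin p.2, z p.1]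

/-- `(r, z)` is the profile curve, parametrized by arc length on the whole line and not meeting
the axis, of a complete surface of revolution with constant mean curvature `H ≠ 0`. -/
structure IsDelaunayProfile (H : ℝ) (r z : ℝ → ℝ) : Prop where
  H_ne : H ≠ 0
  smooth_r : ContDiff ℝ ∞ r
  smooth_z : ContDiff ℝ ∞ z
  unit_speed : ∀ s, deriv r s ^ 2 + deriv z s ^ 2 = 1
  pos : ∀ s, 0 < r s
  mean_curvature : ∀ p, meanCurvature (revolve r z) p = H

/-- An unduloid of mean curvature `H`: a complete rotational surface of constant mean
curvature `H ≠ 0` whose profile curve is a graph over the axis (it is nowhere perpendicular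
to the axis). The circular cylinder is admitted as the degenerate unduloid. -/
def IsUnduloid (H : ℝ) (x : ℝ × ℝ → E3) : Prop :=
  ∃ r z : ℝ → ℝ, x = revolve r z ∧ IsDelaunayProfile H r z ∧ ∀ s, deriv z s ≠ 0

/-- A nodoid of mean curvature `H`: a complete rotational surface of constant mean
curvature `H ≠ 0` whose profile curve is not a graph over the axis
(it is somewhere perpendicular to the axis). -/
def IsNodoid (H : ℝ) (x : ℝ × ℝ → E3) : Prop :=
  ∃ r z : ℝ → ℝ, x = revolve r z ∧ IsDelaunayProfile H r z ∧ ∃ s, deriv z s = 0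

end Delaunay

end

namespace Delaunay

/-! For an arc-length profile the metric is `ds² + r² dt²`, so only `r` matters intrinsically.
Constant mean curvature integrates once to `r z' = H r² + c`. Together with unit speed this makes
the equation for `r²` linear, whence `r² = a + A cos (2H(s - s₀))` with `0 ≤ A < a`
(`IsDelaunayProfile.exists_radius`). The radii are therefore `√(a - A)` and `√(a + A)`, and equality
of the ratios means equality of `A / a`. The sign of `Hc` separates unduloids from nodoids, but the
Gauss curvature `K = -r''/r = H² - c²/r⁴` sees only `c²`.

If the values of `A / a` agree, the two functions `r²` are proportional after a shift of `s`, and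
rescaling the angle gives an isometry. Conversely, local isometries preserve `K`
(`deriv_deriv_mul_eq_of_isometry`). The minimum of `K` is `H² - H² (a + A)/(a - A)`, attained at the
inner radius, so it determines `A / a`; comparing minima in both directions gives equality. -/

/-! ### Fundamental forms of a surface of revolution. -/

theorem fderiv_vec3 {f g h : ℝ × ℝ → ℝ} {p : ℝ × ℝ} (hf : DifferentiableAt ℝ f p)
    (hg : DifferentiableAt ℝ g p) (hh : DifferentiableAt ℝ h p) (v : ℝ × ℝ) :
    fderiv ℝ (fun q => (!₂[f q, g q, h q] : E3)) p v
      = !₂[fderiv ℝ f p v, fderiv ℝ g p v, fderiv ℝ h p v] := by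
  have hd : DifferentiableAt ℝ (fun q => (!₂[f q, g q, h q] : E3)) p := by
    rw [differentiableAt_euclidean]
    intro i
    fin_cases i <;> simpa
  have key : ∀ i : Fin 3, (fderiv ℝ (fun q => (!₂[f q, g q, h q] : E3)) p v) i
      = fderiv ℝ (fun q => (!₂[f q, g q, h q] : E3) i) p v := fun i => by
    have h1 := ((EuclideanSpace.proj i : E3 →L[ℝ] ℝ).hasFDerivAt.comp p
      hd.hasFDerivAt).fderiv
    exact (DFunLike.congr_fun h1 v).symm
  ext i
  rw [key]
  fin_cases i <;> simp

theorem hasFDerivAt_fst_comp {f : ℝ → ℝ} (hf : Differentiable ℝ f) (p : ℝ × ℝ) :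
    HasFDerivAt (fun q : ℝ × ℝ => f q.1) (deriv f p.1 • ContinuousLinearMap.fst ℝ ℝ ℝ) p :=
  (hf p.1).hasDerivAt.comp_hasFDerivAt p hasFDerivAt_fst

set_option linter.unnecessarySeqFocus false in
theorem hasFDerivAt_mul_cos {f : ℝ → ℝ} (hf : Differentiable ℝ f) (p : ℝ × ℝ) :
    HasFDerivAt (fun q : ℝ × ℝ => f q.1 * Real.cos q.2)
      ((deriv f p.1 * Real.cos p.2) • ContinuousLinearMap.fst ℝ ℝ ℝ
        + (-(f p.1 * Real.sin p.2)) • ContinuousLinearMap.snd ℝ ℝ ℝ) p := by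
  have h2 : HasFDerivAt (fun q : ℝ × ℝ => Real.cos q.2) _ p :=
    (Real.hasDerivAt_cos p.2).comp_hasFDerivAt p (hasFDerivAt_snd (𝕜 := ℝ) (p := p))
  refine ((hasFDerivAt_fst_comp hf p).mul h2).congr_fderiv ?_
  ext <;> simp <;> ring

set_option linter.unnecessarySeqFocus false in
theorem hasFDerivAt_mul_sin {f : ℝ → ℝ} (hf : Differentiable ℝ f) (p : ℝ × ℝ) :
    HasFDerivAt (fun q : ℝ × ℝ => f q.1 * Real.sin q.2)
      ((deriv f p.1 * Real.sin p.2) • ContinuousLinearMap.fst ℝ ℝ ℝ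
        + (f p.1 * Real.cos p.2) • ContinuousLinearMap.snd ℝ ℝ ℝ) p := by
  have h2 : HasFDerivAt (fun q : ℝ × ℝ => Real.sin q.2) _ p :=
    (Real.hasDerivAt_sin p.2).comp_hasFDerivAt p (hasFDerivAt_snd (𝕜 := ℝ) (p := p))
  refine ((hasFDerivAt_fst_comp hf p).mul h2).congr_fderiv ?_
  ext <;> simp <;> ring

set_option linter.unnecessarySeqFocus false in
theorem fderiv_revolve {r z : ℝ → ℝ} (hr : Differentiable ℝ r) (hz : Differentiable ℝ z)
    (p v : ℝ × ℝ) :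
    fderiv ℝ (revolve r z) p v =
      !₂[deriv r p.1 * Real.cos p.2 * v.1 - r p.1 * Real.sin p.2 * v.2,
        deriv r p.1 * Real.sin p.2 * v.1 + r p.1 * Real.cos p.2 * v.2, deriv z p.1 * v.1] := by
  have h1 := hasFDerivAt_mul_cos hr p
  have h2 := hasFDerivAt_mul_sin hr p
  have h3 := hasFDerivAt_fst_comp hz p
  unfold revolve
  rw [fderiv_vec3 h1.differentiableAt h2.differentiableAt h3.differentiableAt,
    h1.fderiv, h2.fderiv, h3.fderiv]
  ext i
  fin_cases i <;> simp <;> ring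

theorem partialU_revolve {r z : ℝ → ℝ} (hr : Differentiable ℝ r) (hz : Differentiable ℝ z) :
    partialU (revolve r z) = revolve (deriv r) (deriv z) := by
  ext p i
  rw [partialU, fderiv_revolve hr hz]
  fin_cases i <;> simp [revolve]

theorem partialV_revolve {r z : ℝ → ℝ} (hr : Differentiable ℝ r) (hz : Differentiable ℝ z) :
    partialV (revolve r z)
      = fun p => !₂[-(r p.1 * Real.sin p.2), r p.1 * Real.cos p.2, 0] := by
  ext p i
  rw [partialV, fderiv_revolve hr hz]
  fin_cases i <;> simp

theorem partialV_partialV_revolve {r z : ℝ → ℝ} (hr : Differentiable ℝ r)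
    (hz : Differentiable ℝ z) :
    partialV (partialV (revolve r z))
      = fun p => !₂[-(r p.1 * Real.cos p.2), -(r p.1 * Real.sin p.2), 0] := by
  rw [partialV_revolve hr hz]
  ext p i
  have h1 := hasFDerivAt_mul_cos hr p
  have h2 := (hasFDerivAt_mul_sin hr p).fun_neg
  rw [partialV, fderiv_vec3 h2.differentiableAt h1.differentiableAt (differentiableAt_const _),
    h1.fderiv, h2.fderiv]
  fin_cases i <;> simp

theorem inner_vec3 (a b c a' b' c' : ℝ) :
    inner ℝ (!₂[a, b, c] : E3) !₂[a', b', c'] = a * a' + b * b' + c * c' := by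
  simp [PiLp.inner_apply, Fin.sum_univ_three]; ring

theorem firstForm_revolve {r z : ℝ → ℝ} (hr : Differentiable ℝ r) (hz : Differentiable ℝ z)
    (hu : ∀ s, deriv r s ^ 2 + deriv z s ^ 2 = 1) (p v w : ℝ × ℝ) :
    firstForm (revolve r z) p v w = v.1 * w.1 + r p.1 ^ 2 * (v.2 * w.2) := by
  rw [firstForm, fderiv_revolve hr hz, fderiv_revolve hr hz, inner_vec3]
  linear_combination (v.1 * w.1) * hu p.1 +
    (deriv r p.1 ^ 2 * v.1 * w.1 + r p.1 ^ 2 * (v.2 * w.2)) * Real.sin_sq_add_cos_sq p.2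

theorem gaussMap_revolve {r z : ℝ → ℝ} (hr : Differentiable ℝ r) (hz : Differentiable ℝ z)
    (hu : ∀ s, deriv r s ^ 2 + deriv z s ^ 2 = 1) (hpos : ∀ s, 0 < r s) (p : ℝ × ℝ) :
    gaussMap (revolve r z) p
      = !₂[-(deriv z p.1 * Real.cos p.2), -(deriv z p.1 * Real.sin p.2), deriv r p.1] := by
  have hc : cross (partialU (revolve r z) p) (partialV (revolve r z) p)
      = r p.1 • !₂[-(deriv z p.1 * Real.cos p.2), -(deriv z p.1 * Real.sin p.2), deriv r p.1] := by
    rw [partialU_revolve hr hz, partialV_revolve hr hz]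
    ext i
    have := Real.sin_sq_add_cos_sq p.2
    fin_cases i <;> simp [cross, revolve, cross_apply]
    · ring
    · ring
    · linear_combination (deriv r p.1 * r p.1) * this
  have hn : ‖(!₂[-(deriv z p.1 * Real.cos p.2), -(deriv z p.1 * Real.sin p.2), deriv r p.1] : E3)‖
      = 1 := by
    rw [EuclideanSpace.norm_eq, Real.sqrt_eq_one]
    simp only [Fin.sum_univ_three, Real.norm_eq_abs, sq_abs]
    simp
    linear_combination hu p.1 + (deriv z p.1 ^ 2) * Real.sin_sq_add_cos_sq p.2
  rw [gaussMap, hc, norm_smul, hn, mul_one, smul_smul, Real.norm_of_nonneg (hpos _).le,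
    inv_mul_cancel₀ (hpos _).ne', one_smul]

/-- The parameter curves are orthogonal, so `2H` is the sum of the normal curvatures `z'/r` of the
parallels and `z''r' - r''z'` of the meridians; the factor `r` clears the denominator. -/
theorem meanCurvature_revolve {r z : ℝ → ℝ} (hr : ContDiff ℝ ∞ r) (hz : ContDiff ℝ ∞ z)
    (hu : ∀ s, deriv r s ^ 2 + deriv z s ^ 2 = 1) (hpos : ∀ s, 0 < r s) (p : ℝ × ℝ) :
    2 * r p.1 * meanCurvature (revolve r z) p
      = deriv z p.1 + r p.1 * (deriv (deriv z) p.1 * deriv r p.1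
        - deriv (deriv r) p.1 * deriv z p.1) := by
  have hr1 : Differentiable ℝ r := hr.differentiable (by simp)
  have hz1 : Differentiable ℝ z := hz.differentiable (by simp)
  have hr2 : Differentiable ℝ (deriv r) :=
    ((contDiff_infty_iff_deriv.1 hr).2).differentiable (by simp)
  have hz2 : Differentiable ℝ (deriv z) :=
    ((contDiff_infty_iff_deriv.1 hz).2).differentiable (by simp)
  have e := Real.sin_sq_add_cos_sq p.2
  have hE : inner ℝ (partialU (revolve r z) p) (partialU (revolve r z) p) = (1 : ℝ) := by
    exact (firstForm_revolve hr1 hz1 hu p (1, 0) (1, 0)).trans (by simp)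
  have hF : inner ℝ (partialU (revolve r z) p) (partialV (revolve r z) p) = (0 : ℝ) := by
    exact (firstForm_revolve hr1 hz1 hu p (1, 0) (0, 1)).trans (by simp)
  have hG : inner ℝ (partialV (revolve r z) p) (partialV (revolve r z) p) = r p.1 ^ 2 := by
    exact (firstForm_revolve hr1 hz1 hu p (0, 1) (0, 1)).trans (by simp)
  have hL : inner ℝ (partialU (partialU (revolve r z)) p) (gaussMap (revolve r z) p)
      = deriv (deriv z) p.1 * deriv r p.1 - deriv (deriv r) p.1 * deriv z p.1 := by
    rw [partialU_revolve hr1 hz1, partialU_revolve hr2 hz2, gaussMap_revolve hr1 hz1 hu hpos,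
      revolve, inner_vec3]
    linear_combination (- deriv (deriv r) p.1 * deriv z p.1) * e
  have hN : inner ℝ (partialV (partialV (revolve r z)) p) (gaussMap (revolve r z) p)
      = r p.1 * deriv z p.1 := by
    rw [partialV_partialV_revolve hr1 hz1, gaussMap_revolve hr1 hz1 hu hpos, inner_vec3]
    linear_combination (r p.1 * deriv z p.1) * e
  have h0 := (hpos p.1).ne'
  simp only [meanCurvature, hE, hF, hG, hL, hN]
  field_simp
  ring

/-! ### Integration of the profile equation. -/

/-- A solution of `w'' = -κ² w` is a pure oscillation. -/
theorem exists_amplitude_phase {w w' : ℝ → ℝ} {κ : ℝ} (hκ : κ ≠ 0)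
    (hw : ∀ s, HasDerivAt w (w' s) s) (hw' : ∀ s, HasDerivAt w' (-(κ ^ 2 * w s)) s) :
    ∃ A s₀ : ℝ, 0 ≤ A ∧ ∀ s, w s = A * Real.cos (κ * (s - s₀)) := by
  have hlin : ∀ s : ℝ, HasDerivAt (fun s => κ * s) κ s := fun s => by
    simpa using (hasDerivAt_id s).const_mul κ
  -- The vector `(κ w, w')` rotates uniformly; undoing the rotation leaves two constants of motion.
  have hB : ∀ s, κ * w s * Real.cos (κ * s) - w' s * Real.sin (κ * s)
      = κ * w 0 := fun s => by
    have hd : ∀ s, HasDerivAt (fun s => κ * w s * Real.cos (κ * s) - w' s * Real.sin (κ * s)) 0 s :=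
      fun s => by
        refine ((((hw s).const_mul κ).mul (hlin s).cos).sub ((hw' s).mul (hlin s).sin)).congr_deriv ?_
        ring
    have := is_const_of_deriv_eq_zero (fun s => (hd s).differentiableAt) (fun s => (hd s).deriv) s 0
    simpa using this
  have hD : ∀ s, κ * w s * Real.sin (κ * s) + w' s * Real.cos (κ * s) = w' 0 := fun s => by
    have hd : ∀ s, HasDerivAt (fun s => κ * w s * Real.sin (κ * s) + w' s * Real.cos (κ * s)) 0 s :=
      fun s => by
        refine ((((hw s).const_mul κ).mul (hlin s).sin).add ((hw' s).mul (hlin s).cos)).congr_deriv ?_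
        ring
    have := is_const_of_deriv_eq_zero (fun s => (hd s).differentiableAt) (fun s => (hd s).deriv) s 0
    simpa using this
  -- The modulus and argument of the initial data give amplitude and phase.
  set ζ : ℂ := ⟨w 0, w' 0 / κ⟩ with hζ
  have h1 : ‖ζ‖ * Real.cos ζ.arg = w 0 := Complex.norm_mul_cos_arg ζ
  have h2 : ‖ζ‖ * Real.sin ζ.arg = w' 0 / κ := Complex.norm_mul_sin_arg ζ
  refine ⟨‖ζ‖, ζ.arg / κ, norm_nonneg _, fun s => ?_⟩
  have h3 : κ * (s - ζ.arg / κ) = κ * s - ζ.arg := by field_simp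
  have h2' : κ * (‖ζ‖ * Real.sin ζ.arg) = w' 0 := by rw [h2]; field_simp
  rw [h3, Real.cos_sub]
  apply mul_left_cancel₀ hκ
  linear_combination Real.cos (κ * s) * hB s + Real.sin (κ * s) * hD s
    - κ * Real.cos (κ * s) * h1 - Real.sin (κ * s) * h2'
    - κ * w s * Real.sin_sq_add_cos_sq (κ * s)

/-- The ordinary differential equation of a Delaunay profile in terms of its radius `r`: `c` is the
constant of the first integral `r z' = H r² + c`, and `r²` oscillates about `a` with
amplitude `A`. -/
structure IsDelaunayRadius (H c a A s₀ : ℝ) (r : ℝ → ℝ) : Prop where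
  pos : ∀ s, 0 < r s
  amplitude_nonneg : 0 ≤ A
  amplitude_lt : A < a
  sq_const : H ^ 2 * (a ^ 2 - A ^ 2) = c ^ 2
  sq_eq : ∀ s, r s ^ 2 = a + A * Real.cos (2 * H * (s - s₀))
  deriv_deriv : ∀ s, r s ^ 3 * deriv (deriv r) s = c ^ 2 - H ^ 2 * r s ^ 4

/-- With the first integral, `(r²)'' = 2(r'² + r r'')` becomes `2 - 4H(H r² + c)`, an affine
function of `r²`. The relation between `a`, `A` and `c` is then read off at the extrema of `r`. -/
theorem IsDelaunayProfile.exists_radius {H : ℝ} {r z : ℝ → ℝ} (h : IsDelaunayProfile H r z)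
    (hmean : ∀ s, 2 * r s * H = deriv z s + r s * (deriv (deriv z) s * deriv r s
        - deriv (deriv r) s * deriv z s)) :
    ∃ c a A s₀, IsDelaunayRadius H c a A s₀ r := by
  have hH := h.H_ne
  have hr1 : ∀ s, HasDerivAt r (deriv r s) s := fun s =>
    (h.smooth_r.differentiable (by simp) s).hasDerivAt
  have hr2 : ∀ s, HasDerivAt (deriv r) (deriv (deriv r) s) s := fun s =>
    ((contDiff_infty_iff_deriv.1 h.smooth_r).2.differentiable (by simp) s).hasDerivAt
  have hz2 : ∀ s, HasDerivAt (deriv z) (deriv (deriv z) s) s := fun s =>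
    ((contDiff_infty_iff_deriv.1 h.smooth_z).2.differentiable (by simp) s).hasDerivAt
  have hu := h.unit_speed
  have hu' : ∀ s, deriv r s * deriv (deriv r) s + deriv z s * deriv (deriv z) s = 0 := fun s => by
    have h1 : HasDerivAt (fun s => deriv r s ^ 2 + deriv z s ^ 2) _ s :=
      ((hr2 s).pow 2).add ((hz2 s).pow 2)
    have h2 : HasDerivAt (fun s => deriv r s ^ 2 + deriv z s ^ 2) 0 s := by
      rw [funext hu]; exact hasDerivAt_const _ _
    have := h1.unique h2
    norm_num at this
    linarith
  have hrr : ∀ s, r s * deriv (deriv r) s = deriv z s ^ 2 - 2 * H * r s * deriv z s := fun s => by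
    linear_combination (deriv z s) * hmean s + (- r s * deriv (deriv r) s) * hu s
      + (r s * deriv r s) * hu' s
  obtain ⟨c, hc⟩ : ∃ c, ∀ s, r s * deriv z s = H * r s ^ 2 + c := by
    have hd : ∀ s, HasDerivAt (fun s => r s * deriv z s - H * r s ^ 2) 0 s := fun s => by
      refine (((hr1 s).mul (hz2 s)).sub (((hr1 s).pow 2).const_mul H)).congr_deriv ?_
      norm_num
      linear_combination (-deriv r s) * hmean s + (-r s * deriv (deriv z) s) * hu s
        + (r s * deriv z s) * hu' s
    refine ⟨r 0 * deriv z 0 - H * r 0 ^ 2, fun s => ?_⟩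
    have := is_const_of_deriv_eq_zero (fun s => (hd s).differentiableAt) (fun s => (hd s).deriv) s 0
    linarith
  -- The equilibrium value of `r²`, where `2 - 4H(H r² + c)` vanishes.
  set a : ℝ := (1 - 2 * H * c) / (2 * H ^ 2) with ha
  have ha' : 2 * H ^ 2 * a = 1 - 2 * H * c := by rw [ha]; field_simp
  have hdd : ∀ s, r s ^ 3 * deriv (deriv r) s = c ^ 2 - H ^ 2 * r s ^ 4 := fun s => by
    linear_combination (r s ^ 2) * hrr s + (r s * deriv z s + c - H * r s ^ 2) * hc s
  have hrd : ∀ s, HasDerivAt (fun s => r s ^ 2 - a) (2 * (r s * deriv r s)) s := fun s => by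
    refine (((hr1 s).pow 2).sub_const a).congr_deriv ?_
    norm_num; ring
  obtain ⟨A, s₀, hA, hw⟩ := exists_amplitude_phase (κ := 2 * H) (by simpa using hH) hrd (fun s => by
    refine ((((hr1 s).mul (hr2 s))).const_mul 2).congr_deriv ?_
    linear_combination 2 * hu s + 2 * hrr s - 2 * ha' - 4 * H * hc s)
  have hsq : ∀ s, r s ^ 2 = a + A * Real.cos (2 * H * (s - s₀)) := fun s => by
    linear_combination hw s
  have hrd' : ∀ s, 2 * (r s * deriv r s) = -(A * (2 * H) * Real.sin (2 * H * (s - s₀))) := fun s => by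
    have h1 : HasDerivAt (fun s => 2 * H * (s - s₀)) (2 * H) s := by
      simpa using ((hasDerivAt_id s).sub_const s₀).const_mul (2 * H)
    have h2 := h1.cos.const_mul A
    rw [← funext hw] at h2
    rw [(hrd s).unique h2]; ring
  -- Where `r' = 0`, unit speed forces `z' = ±1`, so the first integral squares to an equation in
  -- `r²`. It is applied at `r² = a + A` and, half a period later, at `r² = a - A`.
  have hcrit : ∀ s, Real.sin (2 * H * (s - s₀)) = 0 → (H * r s ^ 2 + c) ^ 2 = r s ^ 2 := fun s hs => by
    have h1 := hrd' s
    rw [hs] at h1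
    have h2 : deriv r s = 0 := by
      have := (h.pos s).ne'
      simpa [this] using h1
    have := hu s
    rw [h2] at this
    rw [← hc s]
    linear_combination (r s ^ 2) * this
  have hmax := hcrit s₀ (by simp)
  have hshift : 2 * H * ((s₀ + Real.pi / (2 * H)) - s₀) = Real.pi := by field_simp; ring
  have hmin := hcrit (s₀ + Real.pi / (2 * H)) (by rw [hshift]; simp)
  have hlt := h.pos (s₀ + Real.pi / (2 * H))
  have e1 := hsq s₀
  have e2 := hsq (s₀ + Real.pi / (2 * H))
  rw [hshift] at e2
  simp only [sub_self, mul_zero, Real.cos_zero, Real.cos_pi] at e1 e2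
  rw [e1] at hmax
  rw [e2] at hmin
  refine ⟨c, a, A, s₀, h.pos, hA, ?_, ?_, hsq, hdd⟩
  · nlinarith [pow_pos hlt 2]
  · linear_combination (-1 / 2) * (hmax + hmin) + a * ha'

/-! ### Inner and outer radius. -/

theorem IsDelaunayRadius.le_sq {H c a A s₀ : ℝ} {r : ℝ → ℝ} (h : IsDelaunayRadius H c a A s₀ r)
    (s : ℝ) : a - A ≤ r s ^ 2 := by
  rw [h.sq_eq]; nlinarith [Real.neg_one_le_cos (2 * H * (s - s₀)), h.amplitude_nonneg]

theorem IsDelaunayRadius.sq_le {H c a A s₀ : ℝ} {r : ℝ → ℝ} (h : IsDelaunayRadius H c a A s₀ r)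
    (s : ℝ) : r s ^ 2 ≤ a + A := by
  rw [h.sq_eq]; nlinarith [Real.cos_le_one (2 * H * (s - s₀)), h.amplitude_nonneg]

theorem IsDelaunayRadius.exists_min {H c a A s₀ : ℝ} {r : ℝ → ℝ}
    (h : IsDelaunayRadius H c a A s₀ r) (hH : H ≠ 0) : ∃ s, r s ^ 2 = a - A := by
  refine ⟨s₀ + Real.pi / (2 * H), ?_⟩
  rw [h.sq_eq, show 2 * H * ((s₀ + Real.pi / (2 * H)) - s₀) = Real.pi by field_simp; ring]
  simp; ring

theorem IsDelaunayRadius.sq_max {H c a A s₀ : ℝ} {r : ℝ → ℝ} (h : IsDelaunayRadius H c a A s₀ r) :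
    r s₀ ^ 2 = a + A := by
  rw [h.sq_eq]; simp

theorem axisDistances_revolve {r : ℝ → ℝ} (z : ℝ → ℝ) (hr : ∀ s, 0 < r s) :
    axisDistances (revolve r z) = Set.range r := by
  have key : ∀ p : ℝ × ℝ, axisDist (revolve r z p) = r p.1 := fun p => by
    rw [axisDist, ← Real.sqrt_sq (hr p.1).le]
    congr 1
    simp [revolve]
    linear_combination (r p.1 ^ 2) * Real.sin_sq_add_cos_sq p.2
  ext d
  simp [axisDistances, key]

theorem IsDelaunayRadius.isGreatest {H c a A s₀ : ℝ} {r : ℝ → ℝ}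
    (h : IsDelaunayRadius H c a A s₀ r) : IsGreatest (Set.range r) √(a + A) := by
  refine ⟨⟨s₀, ?_⟩, ?_⟩
  · rw [← h.sq_max, Real.sqrt_sq (h.pos _).le]
  · rintro _ ⟨s, rfl⟩
    exact Real.le_sqrt_of_sq_le (h.sq_le s)

theorem IsDelaunayRadius.isLeast {H c a A s₀ : ℝ} {r : ℝ → ℝ}
    (h : IsDelaunayRadius H c a A s₀ r) (hH : H ≠ 0) : IsLeast (Set.range r) √(a - A) := by
  obtain ⟨s, hs⟩ := h.exists_min hH
  refine ⟨⟨s, ?_⟩, ?_⟩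
  · rw [← hs, Real.sqrt_sq (h.pos _).le]
  · rintro _ ⟨s, rfl⟩
    exact (Real.sqrt_le_left (h.pos s).le).2 (h.le_sq s)

/-- The squared ratio is `(1 - u)/(1 + u)` with `u = A / a`, which is injective in `u`. -/
theorem sqrt_div_sqrt_eq_iff {a A b B : ℝ} (hA : 0 ≤ A) (hAa : A < a) (hB : 0 ≤ B) (hBb : B < b) :
    √(a - A) / √(a + A) = √(b - B) / √(b + B) ↔ A * b = B * a := by
  have h1 : 0 < a - A := by linarith
  have h2 : 0 < a + A := by linarith
  have h3 : 0 < b - B := by linarith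
  have h4 : 0 < b + B := by linarith
  rw [← Real.sqrt_div h1.le, ← Real.sqrt_div h3.le, Real.sqrt_inj (by positivity) (by positivity),
    div_eq_div_iff h2.ne' h4.ne']
  constructor <;> intro h <;> linarith

/-! ### Invariance of the Gauss curvature under isometries of warped products. -/

theorem fderiv_apply_eq_of_eqOn {U : Set (ℝ × ℝ)} (hU : IsOpen U) {x : ℝ × ℝ} (hx : x ∈ U)
    {f g : ℝ × ℝ → ℝ} {f' g' : ℝ × ℝ →L[ℝ] ℝ} (h : ∀ q ∈ U, f q = g q)
    (hf : HasFDerivAt f f' x) (hg : HasFDerivAt g g' x) (v : ℝ × ℝ) : f' v = g' v := by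
  rw [hf.unique (hg.congr_of_eventuallyEq (Filter.eventually_of_mem (hU.mem_nhds hx) h))]

theorem contDiffOn_fderiv_apply {U : Set (ℝ × ℝ)} (hU : IsOpen U) {f : ℝ × ℝ → ℝ}
    (hf : ContDiffOn ℝ ∞ f U) (v : ℝ × ℝ) : ContDiffOn ℝ ∞ (fun q => fderiv ℝ f q v) U :=
  (hf.fderiv_of_isOpen hU (by simp)).clm_apply contDiffOn_const

theorem hasFDerivAt_of_contDiffOn {U : Set (ℝ × ℝ)} (hU : IsOpen U) {f : ℝ × ℝ → ℝ}
    (hf : ContDiffOn ℝ ∞ f U) {x : ℝ × ℝ} (hx : x ∈ U) : HasFDerivAt f (fderiv ℝ f x) x :=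
  ((hf.contDiffAt (hU.mem_nhds hx)).differentiableAt (by simp)).hasFDerivAt

theorem fderiv_fderiv_comm {U : Set (ℝ × ℝ)} (hU : IsOpen U) {f : ℝ × ℝ → ℝ}
    (hf : ContDiffOn ℝ ∞ f U) {x : ℝ × ℝ} (hx : x ∈ U) (v w : ℝ × ℝ) :
    fderiv ℝ (fun q => fderiv ℝ f q v) x w = fderiv ℝ (fun q => fderiv ℝ f q w) x v := by
  have hc := hf.contDiffAt (hU.mem_nhds hx)
  have hs := hc.isSymmSndFDerivAt (by simpa using WithTop.coe_le_coe.2 (le_top : (2 : ℕ∞) ≤ ⊤))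
  have hd : DifferentiableAt ℝ (fderiv ℝ f) x :=
    (hc.fderiv_right (m := 1) (by norm_cast)).differentiableAt (by simp)
  have key : ∀ v w, fderiv ℝ (fun q => fderiv ℝ f q v) x w = fderiv ℝ (fderiv ℝ f) x w v :=
    fun v w => by
      rw [(hd.hasFDerivAt.clm_apply (hasFDerivAt_const v x)).fderiv]
      simp
  rw [key, key, hs.eq]

theorem hasFDerivAt_comp_real {ρ : ℝ → ℝ} (hρ : ContDiff ℝ ∞ ρ) {a : ℝ × ℝ → ℝ}
    {a' : ℝ × ℝ →L[ℝ] ℝ} {x : ℝ × ℝ} (ha : HasFDerivAt a a' x) :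
    HasFDerivAt (fun q => ρ (a q)) (deriv ρ (a x) • a') x :=
  (hρ.differentiable (by simp) (a x)).hasDerivAt.comp_hasFDerivAt x ha

/-- The unit gradient `(p, Q)` of a function `a` on the warped product `ds² + ρ² dt²` whose
Laplacian is `(R'/R)(a)` forces the Gauss curvatures `-ρ''/ρ` and `-(R''/R)(a)` to agree. -/
theorem deriv_deriv_mul_eq_of_frame {ρ R : ℝ → ℝ} (hρ : ContDiff ℝ ∞ ρ) (hR : ContDiff ℝ ∞ R)
    (hρ0 : ∀ s, 0 < ρ s) (hR0 : ∀ s, 0 < R s) {U : Set (ℝ × ℝ)} (hU : IsOpen U)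
    {a p Q : ℝ × ℝ → ℝ} (ha : ContDiffOn ℝ ∞ a U) (hp : ContDiffOn ℝ ∞ p U)
    (hQ : ContDiffOn ℝ ∞ Q U) (has : ∀ x ∈ U, fderiv ℝ a x (1, 0) = p x)
    (hat : ∀ x ∈ U, fderiv ℝ a x (0, 1) = ρ x.1 * Q x) (hpQ : ∀ x ∈ U, p x ^ 2 + Q x ^ 2 = 1)
    (hdiv : ∀ x ∈ U, R (a x) * (fderiv ℝ Q x (0, 1) + deriv ρ x.1 * p x
      + ρ x.1 * fderiv ℝ p x (1, 0)) = ρ x.1 * deriv R (a x)) {x : ℝ × ℝ} (hx : x ∈ U) :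
    deriv (deriv ρ) x.1 * R (a x) = deriv (deriv R) (a x) * ρ x.1 := by
  have hρ' : ContDiff ℝ ∞ (deriv ρ) := (contDiff_infty_iff_deriv.1 hρ).2
  have hR' : ContDiff ℝ ∞ (deriv R) := (contDiff_infty_iff_deriv.1 hR).2
  have da : ∀ x ∈ U, HasFDerivAt a (fderiv ℝ a x) x := fun x => hasFDerivAt_of_contDiffOn hU ha
  have dp : ∀ x ∈ U, HasFDerivAt p (fderiv ℝ p x) x := fun x => hasFDerivAt_of_contDiffOn hU hp
  have dQ : ∀ x ∈ U, HasFDerivAt Q (fderiv ℝ Q x) x := fun x => hasFDerivAt_of_contDiffOn hU hQ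
  have dRa : ∀ x ∈ U, HasFDerivAt (fun q => R (a q)) _ x :=
    fun x hx => hasFDerivAt_comp_real hR (da x hx)
  have dR'a : ∀ x ∈ U, HasFDerivAt (fun q => deriv R (a q)) _ x :=
    fun x hx => hasFDerivAt_comp_real hR' (da x hx)
  have dρ : ∀ x : ℝ × ℝ, HasFDerivAt (fun q : ℝ × ℝ => ρ q.1) _ x :=
    fun x => hasFDerivAt_comp_real hρ hasFDerivAt_fst
  have dρ' : ∀ x : ℝ × ℝ, HasFDerivAt (fun q : ℝ × ℝ => deriv ρ q.1) _ x :=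
    fun x => hasFDerivAt_comp_real hρ' hasFDerivAt_fst
  -- closedness of `da`
  have hcl : ∀ x ∈ U, fderiv ℝ p x (0, 1) = deriv ρ x.1 * Q x + ρ x.1 * fderiv ℝ Q x (1, 0) :=
    fun x hx => by
      have h1 := fderiv_fderiv_comm hU ha hx (1, 0) (0, 1)
      have h2 := fderiv_apply_eq_of_eqOn hU hx has
        (hasFDerivAt_of_contDiffOn hU (contDiffOn_fderiv_apply hU ha _) hx) (dp x hx) (0, 1)
      have h3 := fderiv_apply_eq_of_eqOn hU hx hat
        (hasFDerivAt_of_contDiffOn hU (contDiffOn_fderiv_apply hU ha _) hx)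
        ((dρ x).mul (dQ x hx)) (1, 0)
      simp at h3
      rw [← h2, h1, h3]; ring
  have hunit : ∀ x ∈ U, ∀ v, p x * fderiv ℝ p x v + Q x * fderiv ℝ Q x v = 0 := fun x hx v => by
    have h1 := fderiv_apply_eq_of_eqOn hU hx hpQ (((dp x hx).pow 2).add ((dQ x hx).pow 2))
      (hasFDerivAt_const (1 : ℝ) x) v
    simp at h1
    linarith
  -- the first derivatives of the frame
  have hps : ∀ x ∈ U, R (a x) * fderiv ℝ p x (1, 0) = Q x ^ 2 * deriv R (a x) := fun x hx => by
    have h0 := (hρ0 x.1).ne'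
    have e1 := hcl x hx
    have e2 := hunit x hx (1, 0)
    have e3 := hunit x hx (0, 1)
    have e4 := hdiv x hx
    have e5 := hpQ x hx
    apply mul_left_cancel₀ h0
    linear_combination (Q x ^ 2) * e4 - (Q x * R (a x)) * e3 + (Q x * R (a x) * p x) * e1
      + (R (a x) * ρ x.1 * p x) * e2 - (R (a x) * ρ x.1 * fderiv ℝ p x (1, 0)) * e5
  have hQs : ∀ x ∈ U, R (a x) * fderiv ℝ Q x (1, 0) = -(p x * Q x * deriv R (a x)) := fun x hx => by
    have h0 := (hρ0 x.1).ne'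
    apply mul_left_cancel₀ h0
    linear_combination (ρ x.1 * R (a x) * Q x) * hunit x hx (1, 0) - (p x * Q x) * hdiv x hx
      + (p x * R (a x)) * hunit x hx (0, 1) - (p x ^ 2 * R (a x)) * hcl x hx
      - (ρ x.1 * R (a x) * fderiv ℝ Q x (1, 0)) * hpQ x hx
  have hpt : ∀ x ∈ U, R (a x) * fderiv ℝ p x (0, 1)
      = Q x * (R (a x) * deriv ρ x.1 - p x * ρ x.1 * deriv R (a x)) := fun x hx => by
    linear_combination (R (a x)) * hcl x hx + ρ x.1 * hQs x hx
  have hQt : ∀ x ∈ U, R (a x) * fderiv ℝ Q x (0, 1)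
      = -(p x * (R (a x) * deriv ρ x.1 - p x * ρ x.1 * deriv R (a x))) := fun x hx => by
    linear_combination hdiv x hx - ρ x.1 * hps x hx - (ρ x.1 * deriv R (a x)) * hpQ x hx
  -- their cross derivatives
  have c1 := fderiv_apply_eq_of_eqOn hU hx hps ((dRa x hx).mul
    (hasFDerivAt_of_contDiffOn hU (contDiffOn_fderiv_apply hU hp (1, 0)) hx))
    (((dQ x hx).pow 2).mul (dR'a x hx)) (0, 1)
  have c2 := fderiv_apply_eq_of_eqOn hU hx hpt ((dRa x hx).mul
    (hasFDerivAt_of_contDiffOn hU (contDiffOn_fderiv_apply hU hp (0, 1)) hx))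
    ((dQ x hx).mul (((dRa x hx).mul (dρ' x)).sub (((dp x hx).mul (dρ x)).mul (dR'a x hx)))) (1, 0)
  have c3 := fderiv_apply_eq_of_eqOn hU hx hQs ((dRa x hx).mul
    (hasFDerivAt_of_contDiffOn hU (contDiffOn_fderiv_apply hU hQ (1, 0)) hx))
    ((((dp x hx).mul (dQ x hx)).mul (dR'a x hx)).neg) (0, 1)
  have c4 := fderiv_apply_eq_of_eqOn hU hx hQt ((dRa x hx).mul
    (hasFDerivAt_of_contDiffOn hU (contDiffOn_fderiv_apply hU hQ (0, 1)) hx))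
    (((dp x hx).mul (((dRa x hx).mul (dρ' x)).sub
      (((dp x hx).mul (dρ x)).mul (dR'a x hx)))).neg) (1, 0)
  have s1 := fderiv_fderiv_comm hU hp hx (1, 0) (0, 1)
  have s2 := fderiv_fderiv_comm hU hQ hx (1, 0) (0, 1)
  simp [has x hx, hat x hx] at c1 c2 c3 c4
  rw [s1] at c1
  rw [s2] at c3
  -- Equality of the mixed derivatives of `p` yields `Q` times the curvature defect, and that of `Q`
  -- yields `p` times it. Since `p² + Q² = 1`, the defect vanishes.
  have k1 : R (a x) * (Q x * (R (a x) * deriv (deriv ρ) x.1 - ρ x.1 * deriv (deriv R) (a x)))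
      = 0 := by
    linear_combination (R (a x)) * (c1 - c2) + (R (a x) * deriv R (a x)) * hunit x hx (0, 1)
      + (deriv R (a x) * Q x) * hQt x hx
      + (deriv R (a x) * p x * ρ x.1 - R (a x) * deriv ρ x.1) * hQs x hx
      + (R (a x) * Q x * ρ x.1 * deriv (deriv R) (a x)) * hpQ x hx
  have k2 : R (a x) * (p x * (R (a x) * deriv (deriv ρ) x.1 - ρ x.1 * deriv (deriv R) (a x)))
      = 0 := by
    linear_combination (R (a x)) * (c4 - c3)
      + (R (a x) * deriv R (a x) * ρ x.1) * hunit x hx (1, 0) + (deriv R (a x) * Q x) * hpt x hx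
      + (deriv R (a x) * p x * ρ x.1 - R (a x) * deriv ρ x.1) * hps x hx
      + (R (a x) * p x * ρ x.1 * deriv (deriv R) (a x)) * hpQ x hx
  apply mul_left_cancel₀ (hR0 (a x)).ne'
  linear_combination Q x * k1 + p x * k2
    - R (a x) * (R (a x) * deriv (deriv ρ) x.1 - ρ x.1 * deriv (deriv R) (a x)) * hpQ x hx

/-- Invariance of the Gauss curvature `-ρ''/ρ` under the isometries `(a, b)` of the warped product
`ds² + ρ² dt²` into `ds² + R² dt²`. -/
theorem deriv_deriv_mul_eq_of_isometry {ρ R : ℝ → ℝ} (hρ : ContDiff ℝ ∞ ρ) (hR : ContDiff ℝ ∞ R)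
    (hρ0 : ∀ s, 0 < ρ s) (hR0 : ∀ s, 0 < R s) {U : Set (ℝ × ℝ)} (hU : IsOpen U)
    {a b : ℝ × ℝ → ℝ} (ha : ContDiffOn ℝ ∞ a U) (hb : ContDiffOn ℝ ∞ b U)
    (hiso : ∀ x ∈ U, ∀ v w : ℝ × ℝ, fderiv ℝ a x v * fderiv ℝ a x w
      + R (a x) ^ 2 * (fderiv ℝ b x v * fderiv ℝ b x w) = v.1 * w.1 + ρ x.1 ^ 2 * (v.2 * w.2))
    {x : ℝ × ℝ} (hx : x ∈ U) :
    deriv (deriv ρ) x.1 * R (a x) = deriv (deriv R) (a x) * ρ x.1 := by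
  set p : ℝ × ℝ → ℝ := fun x => fderiv ℝ a x (1, 0) with hp_def
  set m : ℝ × ℝ → ℝ := fun x => fderiv ℝ a x (0, 1) with hm_def
  set n : ℝ × ℝ → ℝ := fun x => fderiv ℝ b x (1, 0) with hn_def
  set l : ℝ × ℝ → ℝ := fun x => fderiv ℝ b x (0, 1) with hl_def
  set Q : ℝ × ℝ → ℝ := fun x => (ρ x.1)⁻¹ * m x with hQ_def
  -- The Jacobian determinant in the orthonormal frames: `1` or `-1` according to orientation.
  set ε : ℝ × ℝ → ℝ := fun x => (ρ x.1)⁻¹ * (R (a x) * (p x * l x - m x * n x)) with hε_def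
  have sp : ContDiffOn ℝ ∞ p U := contDiffOn_fderiv_apply hU ha _
  have sm : ContDiffOn ℝ ∞ m U := contDiffOn_fderiv_apply hU ha _
  have sn : ContDiffOn ℝ ∞ n U := contDiffOn_fderiv_apply hU hb _
  have sl : ContDiffOn ℝ ∞ l U := contDiffOn_fderiv_apply hU hb _
  have sρ : ContDiffOn ℝ ∞ (fun x : ℝ × ℝ => (ρ x.1)⁻¹) U :=
    ((hρ.comp contDiff_fst).inv fun x => (hρ0 x.1).ne').contDiffOn
  have sQ : ContDiffOn ℝ ∞ Q U := sρ.mul sm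
  have sε : ContDiffOn ℝ ∞ ε U :=
    sρ.mul ((hR.comp_contDiffOn ha).mul ((sp.mul sl).sub (sm.mul sn)))
  have g1 : ∀ x ∈ U, p x ^ 2 + R (a x) ^ 2 * n x ^ 2 = 1 := fun x hx => by
    have := hiso x hx (1, 0) (1, 0)
    simp only [hp_def, hn_def]
    norm_num at this
    linarith
  have g2 : ∀ x ∈ U, p x * m x + R (a x) ^ 2 * (n x * l x) = 0 := fun x hx => by
    have := hiso x hx (1, 0) (0, 1)
    simp only [hp_def, hn_def, hm_def, hl_def]
    norm_num at this
    linarith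
  have g3 : ∀ x ∈ U, m x ^ 2 + R (a x) ^ 2 * l x ^ 2 = ρ x.1 ^ 2 := fun x hx => by
    have := hiso x hx (0, 1) (0, 1)
    simp only [hl_def, hm_def]
    norm_num at this
    linarith
  have hm : ∀ x, m x = ρ x.1 * Q x := fun x => by
    rw [hQ_def]; field_simp [(hρ0 x.1).ne']
  have hε : ∀ x, R (a x) * (p x * l x - m x * n x) = ρ x.1 * ε x := fun x => by
    rw [hε_def]; field_simp [(hρ0 x.1).ne']
  -- The squared determinant is the Gram determinant.
  have hεsq : ∀ x ∈ U, ε x ^ 2 = 1 := fun x hx => by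
    have h0 := pow_ne_zero 2 (hρ0 x.1).ne'
    apply mul_left_cancel₀ h0
    linear_combination (-(R (a x) * (p x * l x - m x * n x) + ρ x.1 * ε x)) * hε x
      + (m x ^ 2 + R (a x) ^ 2 * l x ^ 2) * g1 x hx + g3 x hx
      - (p x * m x + R (a x) ^ 2 * (n x * l x)) * g2 x hx
  -- In an orthonormal coframe, `R(a) db` is `da` rotated by a right angle, up to the sign `ε`.
  have hn : ∀ x ∈ U, R (a x) * n x = -(ε x * Q x) := fun x hx => by
    have h0 := pow_ne_zero 2 (hρ0 x.1).ne'
    apply mul_left_cancel₀ h0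
    have := hm x
    linear_combination (-R (a x) * n x) * g3 x hx + (R (a x) * l x) * g2 x hx
      - m x * hε x - ρ x.1 * ε x * this
  have hl : ∀ x ∈ U, R (a x) * l x = ε x * (ρ x.1 * p x) := fun x hx => by
    linear_combination (-R (a x) * l x) * g1 x hx + (R (a x) * n x) * g2 x hx + p x * hε x
  have hpQ : ∀ x ∈ U, p x ^ 2 + Q x ^ 2 = 1 := fun x hx => by
    have h0 := pow_ne_zero 2 (hρ0 x.1).ne'
    apply mul_left_cancel₀ h0
    linear_combination g3 x hx - (m x + ρ x.1 * Q x) * hm x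
      - (R (a x) * l x + ε x * (ρ x.1 * p x)) * hl x hx - (ρ x.1 ^ 2 * p x ^ 2) * hεsq x hx
  refine deriv_deriv_mul_eq_of_frame hρ hR hρ0 hR0 hU ha sp sQ (fun _ _ => rfl)
    (fun x _ => hm x) hpQ (fun x hx => ?_) hx
  have dp := hasFDerivAt_of_contDiffOn hU sp hx
  have dn := hasFDerivAt_of_contDiffOn hU sn hx
  have dl := hasFDerivAt_of_contDiffOn hU sl hx
  have dQ := hasFDerivAt_of_contDiffOn hU sQ hx
  have dε := hasFDerivAt_of_contDiffOn hU sε hx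
  have dRa := hasFDerivAt_comp_real hR (hasFDerivAt_of_contDiffOn hU ha hx)
  have dρ : HasFDerivAt (fun q : ℝ × ℝ => ρ q.1) _ x := hasFDerivAt_comp_real hρ hasFDerivAt_fst
  have hε0 : ε x ≠ 0 := fun h => by simpa [h] using hεsq x hx
  -- Differentiating `ε² = 1` lets the orientation sign pass through derivatives.
  have hdε : ∀ v, fderiv ℝ ε x v = 0 := fun v => by
    have h1 := fderiv_apply_eq_of_eqOn hU hx hεsq (dε.pow 2) (hasFDerivAt_const (1 : ℝ) x) v
    simpa [hε0] using h1
  have hB := fderiv_apply_eq_of_eqOn hU hx hn (dRa.mul dn) ((dε.mul dQ).neg) (0, 1)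
  have hC := fderiv_apply_eq_of_eqOn hU hx hl (dRa.mul dl) (dε.mul (dρ.mul dp)) (1, 0)
  -- Closedness of `db`, rewritten through `hn` and `hl`, is the equation for the Laplacian of `a`.
  have hs : fderiv ℝ n x (0, 1) = fderiv ℝ l x (1, 0) := fderiv_fderiv_comm hU hb hx (1, 0) (0, 1)
  have hpx : fderiv ℝ a x (1, 0) = p x := rfl
  have hmx : fderiv ℝ a x (0, 1) = m x := rfl
  simp [hdε, hpx, hmx] at hB hC
  apply mul_left_cancel₀ hε0
  linear_combination R (a x) * (hB - hC - R (a x) * hs) + deriv R (a x) * hε x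

/-! ### Local isometry in terms of the ratio of amplitude to mean. -/

theorem IsDelaunayProfile.firstForm_eq {H : ℝ} {r z : ℝ → ℝ} (h : IsDelaunayProfile H r z)
    (p v w : ℝ × ℝ) :
    firstForm (revolve r z) p v w = v.1 * w.1 + r p.1 ^ 2 * (v.2 * w.2) :=
  firstForm_revolve (h.smooth_r.differentiable (by simp)) (h.smooth_z.differentiable (by simp))
    h.unit_speed p v w

theorem IsDelaunayProfile.exists_isDelaunayRadius {H : ℝ} {r z : ℝ → ℝ}
    (h : IsDelaunayProfile H r z) : ∃ c a A s₀, IsDelaunayRadius H c a A s₀ r :=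
  h.exists_radius fun s => by
    have h1 := meanCurvature_revolve h.smooth_r h.smooth_z h.unit_speed h.pos (s, 0)
    rwa [h.mean_curvature] at h1

theorem LocallyIsometricInto.deriv_deriv_mul_eq {H H' : ℝ} {r z ρ ζ : ℝ → ℝ}
    (h : IsDelaunayProfile H r z) (h' : IsDelaunayProfile H' ρ ζ)
    (hiso : LocallyIsometricInto (revolve r z) (revolve ρ ζ)) (s : ℝ) :
    ∃ s', deriv (deriv r) s * ρ s' = deriv (deriv ρ) s' * r s := by
  obtain ⟨φ, hp, hφ, -, hform⟩ := hiso (s, 0)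
  have ha : ContDiffOn ℝ ∞ (fun q => (φ q).1) φ.source := contDiff_fst.comp_contDiffOn hφ
  have hb : ContDiffOn ℝ ∞ (fun q => (φ q).2) φ.source := contDiff_snd.comp_contDiffOn hφ
  refine ⟨(φ (s, 0)).1, deriv_deriv_mul_eq_of_isometry h.smooth_r h'.smooth_r h.pos h'.pos
    φ.open_source ha hb (fun x hx v w => ?_) hp⟩
  have hd : DifferentiableAt ℝ φ x :=
    (hφ.contDiffAt (φ.open_source.mem_nhds hx)).differentiableAt (by simp)
  have h1 := hform x hx v w
  rw [h.firstForm_eq, h'.firstForm_eq] at h1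
  rw [(hd.hasFDerivAt.fst).fderiv, (hd.hasFDerivAt.snd).fderiv]
  exact h1

/-- The least Gauss curvature of the first surface, taken at its inner radius, also occurs on the
second, hence is at least the minimum there. This says `(a + A)/(a - A) ≤ (a' + A')/(a' - A')`. -/
theorem LocallyIsometricInto.amplitude_mul_le {H : ℝ} {r z ρ ζ : ℝ → ℝ}
    (h : IsDelaunayProfile H r z) (h' : IsDelaunayProfile H ρ ζ) {c a A s₀ c' a' A' s₀' : ℝ}
    (hr : IsDelaunayRadius H c a A s₀ r) (hρ : IsDelaunayRadius H c' a' A' s₀' ρ)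
    (hiso : LocallyIsometricInto (revolve r z) (revolve ρ ζ)) : A * a' ≤ A' * a := by
  obtain ⟨s, hs⟩ := hr.exists_min h.H_ne
  obtain ⟨s', hs'⟩ := hiso.deriv_deriv_mul_eq h h' s
  have hH : 0 < H ^ 2 := by have := h.H_ne; positivity
  -- Equal curvatures with the same `H` mean `c²/r⁴ = c'²/ρ⁴`.
  have h1 : c ^ 2 * (ρ s' ^ 2) ^ 2 = c' ^ 2 * (r s ^ 2) ^ 2 := by
    linear_combination (r s ^ 3 * ρ s' ^ 3) * hs' - (ρ s' ^ 4) * hr.deriv_deriv s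
      + (r s ^ 4) * hρ.deriv_deriv s'
  have hle := hρ.le_sq s'
  rw [hs, ← hr.sq_const, ← hρ.sq_const] at h1
  have p1 : 0 < a - A := sub_pos.2 hr.amplitude_lt
  have p2 : 0 < a' - A' := sub_pos.2 hρ.amplitude_lt
  have h2 : (a + A) * (ρ s' ^ 2) ^ 2 = (a' + A') * (a' - A') * (a - A) := by
    have : H ^ 2 * (a - A) ≠ 0 := by positivity
    apply mul_left_cancel₀ this
    linear_combination h1
  have p3 : 0 < a + A := by linarith [hr.amplitude_nonneg]
  have h3 : (a' - A') ^ 2 ≤ (ρ s' ^ 2) ^ 2 := pow_le_pow_left₀ p2.le hle 2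
  have h4 : (a' - A') * ((a + A) * (a' - A')) ≤ (a' - A') * ((a' + A') * (a - A)) := by
    nlinarith
  have h5 := le_of_mul_le_mul_left h4 p2
  linarith

/-- The isometry `(s, t) ↦ (s + d, t / μ)` between warped products. -/
theorem locallyIsometricInto_of_proportional {H : ℝ} {r z ρ ζ : ℝ → ℝ}
    (h : IsDelaunayProfile H r z) (h' : IsDelaunayProfile H ρ ζ) {d μ : ℝ} (hμ : 0 < μ)
    (hprop : ∀ s, ρ (s + d) ^ 2 = μ ^ 2 * r s ^ 2) :
    LocallyIsometricInto (revolve r z) (revolve ρ ζ) := fun p => by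
  let e : (ℝ × ℝ) ≃ₜ (ℝ × ℝ) :=
    (Homeomorph.addRight d).prodCongr (Homeomorph.mulLeft₀ μ⁻¹ (inv_ne_zero hμ.ne'))
  have he : ∀ q, e q = (q.1 + d, μ⁻¹ * q.2) := fun q => rfl
  have hes : ∀ q, e.symm q = (q.1 + -d, μ * q.2) := fun q => by
    apply e.injective
    rw [e.apply_symm_apply, he]
    ext <;> simp [hμ.ne']
  have hd : ∀ q v, fderiv ℝ e q v = (v.1, μ⁻¹ * v.2) := fun q v => by
    have h1 : HasFDerivAt (fun q : ℝ × ℝ => (q.1 + d, μ⁻¹ * q.2)) _ q :=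
      ((hasFDerivAt_fst (𝕜 := ℝ) (p := q)).add_const d).prodMk
        ((hasFDerivAt_snd (𝕜 := ℝ) (p := q)).const_mul μ⁻¹)
    rw [show (e : ℝ × ℝ → ℝ × ℝ) = _ from funext he, h1.fderiv]
    simp
  refine ⟨e.toOpenPartialHomeomorph, by simp, ?_, ?_, fun q _ v w => ?_⟩
  · have : ContDiff ℝ ∞ e := by
      rw [show (e : ℝ × ℝ → ℝ × ℝ) = _ from funext he]; fun_prop
    exact this.contDiffOn
  · have : ContDiff ℝ ∞ e.symm := by
      rw [show (e.symm : ℝ × ℝ → ℝ × ℝ) = _ from funext hes]; fun_prop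
    exact this.contDiffOn
  · rw [h.firstForm_eq, h'.firstForm_eq, Homeomorph.toOpenPartialHomeomorph_apply, hd, hd, he]
    simp only [hprop]
    field_simp

theorem locallyIsometricInto_of_amplitude {H : ℝ} {r z ρ ζ : ℝ → ℝ}
    (h : IsDelaunayProfile H r z) (h' : IsDelaunayProfile H ρ ζ) {c a A s₀ c' a' A' s₀' : ℝ}
    (hr : IsDelaunayRadius H c a A s₀ r) (hρ : IsDelaunayRadius H c' a' A' s₀' ρ)
    (heq : A * a' = A' * a) : LocallyIsometricInto (revolve r z) (revolve ρ ζ) := by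
  have p1 : 0 < a := hr.amplitude_nonneg.trans_lt hr.amplitude_lt
  have p2 : 0 < a' := hρ.amplitude_nonneg.trans_lt hρ.amplitude_lt
  -- The shift aligns the maxima of the radii; `μ²` is the ratio of the means of their squares.
  refine locallyIsometricInto_of_proportional h h' (d := s₀' - s₀) (μ := √(a' / a))
    (by positivity) fun s => ?_
  rw [Real.sq_sqrt (by positivity), hρ.sq_eq, hr.sq_eq, show s + (s₀' - s₀) - s₀' = s - s₀ by ring]
  field_simp
  linear_combination -Real.cos (2 * H * (s - s₀)) * heq

theorem IsDelaunayRadius.innerRadius_eq {H c a A s₀ : ℝ} {r : ℝ → ℝ}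
    (h : IsDelaunayRadius H c a A s₀ r) (hH : H ≠ 0) (z : ℝ → ℝ) :
    innerRadius (revolve r z) = √(a - A) := by
  rw [innerRadius, axisDistances_revolve z h.pos]
  exact (h.isLeast hH).csInf_eq

theorem IsDelaunayRadius.outerRadius_eq {H c a A s₀ : ℝ} {r : ℝ → ℝ}
    (h : IsDelaunayRadius H c a A s₀ r) (z : ℝ → ℝ) :
    outerRadius (revolve r z) = √(a + A) := by
  rw [outerRadius, axisDistances_revolve z h.pos]
  exact h.isGreatest.csSup_eq

end Delaunay

theorem corollary6p13 (H : ℝ) (x y : ℝ × ℝ → Delaunay.E3)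
    (hx : Delaunay.IsUnduloid H x) (hy : Delaunay.IsNodoid H y) :
    BddAbove (Delaunay.axisDistances x) ∧ BddAbove (Delaunay.axisDistances y) ∧
    (Delaunay.LocallyIsometric x y ↔
      Delaunay.innerRadius x / Delaunay.outerRadius x =
        Delaunay.innerRadius y / Delaunay.outerRadius y) := by
  obtain ⟨r, z, rfl, h, -⟩ := hx
  obtain ⟨ρ, ζ, rfl, h', -⟩ := hy
  obtain ⟨c, a, A, s₀, hr⟩ := h.exists_isDelaunayRadius
  obtain ⟨c', a', A', s₀', hρ⟩ := h'.exists_isDelaunayRadius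
  refine ⟨?_, ?_, ?_⟩
  · rw [Delaunay.axisDistances_revolve z h.pos]
    exact hr.isGreatest.bddAbove
  · rw [Delaunay.axisDistances_revolve ζ h'.pos]
    exact hρ.isGreatest.bddAbove
  rw [hr.innerRadius_eq h.H_ne, hr.outerRadius_eq, hρ.innerRadius_eq h.H_ne, hρ.outerRadius_eq,
    Delaunay.sqrt_div_sqrt_eq_iff hr.amplitude_nonneg hr.amplitude_lt hρ.amplitude_nonneg
      hρ.amplitude_lt]
  constructor
  · rintro ⟨h1, h2⟩
    exact le_antisymm (h1.amplitude_mul_le h h' hr hρ) (h2.amplitude_mul_le h' h hρ hr)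
  · intro heq
    exact ⟨Delaunay.locallyIsometricInto_of_amplitude h h' hr hρ heq,
      Delaunay.locallyIsometricInto_of_amplitude h' h hρ hr heq.symm⟩
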